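/- **Setting.** Let $M$ be a finite set of men and $W$ a finite set of women with $|M|=|W|$. Every man $m$ has a strict total order $\succ_m$ on $W$ and every woman $w$ a strict total order $\succ_w$ on $M$; these lists form the (true) profile $\succ$, and $x \succeq_a y$ means $x \succ_a y$ or $x=y$. For a profile $P$ let $\mathrm{DA}(P)$ be the matching (a bijection between $M$ and $W$) computed by the men-proposing deferred acceptance algorithm: in every round each man's offer stands with his favourite woman among those who have not yet rejected him, each woman keeps her favourite standing offer and rejects the others, and the algorithm stops when there is no new rejection. Fix a man $m$, the accomplice, and put $\mu=\mathrm{DA}(\succ)$. A strategy of $m$ is any strict total order $\succ'_m$ on $W$; its outcome is $\mu'=\mathrm{DA}(\succ_{-m},\succ'_m)$, where everybody else reports truthfully. The strategy is *no-regret* if $\mu'(m)\succeq_m\mu(m)$. A no-regret strategy with outcome $\mu'$ is an *optimal one-for-all strategy* if $\mu'(w)\succeq_w\mu(w)$ for every $w\in W$ and, for every no-regret strategy of $m$ with outcome $\mu''$, $\mu'(w)\succeq_w\mu''(w)$ for every $w\in W$. For $X\subseteq W$, a list is obtained by *pushing up $X$* in the true list of $m$ if the women it ranks above $\mu(m)$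 are exactly those in $\{w: w\succ_m\mu(m)\}\cup(X\setminus\{\mu(m)\})$. The positions within the parts above and below $\mu(m)$ are arbitrary. Write $\succ_m^{X\uparrow}$ for the list of this kind in which $\mu(m)$ comes first among the remaining women and the true order is kept inside each part. Let $$W^{NR}=\{w\in W:\ \succ_m^{\{w\}\uparrow}\text{ is a no-regret strategy}\}.$$ **Theorem.** For every profile $\succ$ and every man $m$, an optimal one-for-all strategy of $m$ exists. Moreover, $\succ_m^{W^{NR}\uparrow}$ is an optimal one-for-all strategy, and so is every list obtained by pushing up $W^{NR}$ in the true list of $m$, whatever the positions within the parts above and below $\mu(m)$. -/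

import Mathlib

/-- A preference list over `α`: a strict total order, `L.prefers x y` meaning that `x` is ranked
above `y`. -/
structure PrefList (α : Type*) where
  prefers : α → α → Prop
  irrefl : ∀ x, ¬ prefers x x
  trans : ∀ x y z, prefers x y → prefers y z → prefers x z
  total : ∀ x y, x ≠ y → prefers x y ∨ prefers y x

namespace PrefList

/-- Weak preference: `x` is ranked above `y`, or `x = y`. -/
def weaklyPrefers {α : Type*} (L : PrefList α) (x y : α) : Prop :=
  L.prefers x y ∨ x = y

/-- Over a finite set of alternatives, every nonempty subset has a favourite. -/
theorem exists_favourite {α : Type*} [Finite α] (L : PrefList α) {S : Set α} (hS : S.Nonempty) :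
    ∃ x ∈ S, ∀ y ∈ S, y ≠ x → L.prefers x y := by
  have htr : IsTrans α L.prefers := ⟨L.trans⟩
  have hir : Std.Irrefl L.prefers := ⟨L.irrefl⟩
  have hwf : WellFounded L.prefers := Finite.wellFounded_of_trans_of_irrefl L.prefers
  obtain ⟨x, hx, hmin⟩ := hwf.has_min S hS
  exact ⟨x, hx, fun y hy hne => (L.total y x hne).resolve_left (hmin y hy)⟩

/-- The elements ranked above `a` once the set `X` has been pushed up above `a`: those that were above
`a` already, together with `X` (`a` itself keeps its role as the dividing point). -/
def upperPart {α : Type*} (L : PrefList α) (a : α) (X : Set α) : Set α :=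
  {x | L.prefers x a ∨ (x ∈ X ∧ x ≠ a)}

/-- Push up the set `X` above `a` in the list `L`: the elements of `upperPart` come first, then `a`,
then all the others; inside each of the parts the order of `L` is kept. (No element outside
`upperPart` is above `a` in `L`, so that `a` is automatically the first one of the remainder.) -/
def pushUp {α : Type*} (L : PrefList α) (a : α) (X : Set α) : PrefList α where
  prefers x y :=
    (x ∈ L.upperPart a X ∧ y ∉ L.upperPart a X) ∨
      ((x ∈ L.upperPart a X ↔ y ∈ L.upperPart a X) ∧ L.prefers x y)
  irrefl x := by
    have := L.irrefl x
    tauto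
  trans x y z := by
    have := L.trans x y z
    by_cases hx : x ∈ L.upperPart a X <;> by_cases hy : y ∈ L.upperPart a X <;>
      by_cases hz : z ∈ L.upperPart a X <;> simp_all
  total x y hxy := by
    have := L.total x y hxy
    by_cases hx : x ∈ L.upperPart a X <;> by_cases hy : y ∈ L.upperPart a X <;> simp_all

/-- `L'` arises from `L` by pushing up the set `X` above `a`, the positions inside the parts above
and below `a` being arbitrary. -/
def IsPushUp {α : Type*} (L : PrefList α) (a : α) (X : Set α) (L' : PrefList α) : Prop :=
  ∀ x, L'.prefers x a ↔ x ∈ L.upperPart a X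

end PrefList

/-- A preference profile of a stable marriage instance with men `M` and women `W`, equally many of
each. -/
structure Profile (M W : Type*) where
  man : M → PrefList W
  woman : W → PrefList M
  card_eq : Nat.card M = Nat.card W

namespace Profile

/-! ### The men-proposing deferred acceptance algorithm

The state of the algorithm is the set `R` of pairs `(m, w)` such that `w` has rejected `m`. A man
whose offer is tentatively held keeps this offer, and this is his favourite woman among
those who have not rejected him; an unmatched man makes a new offer to his favourite
among those who have not rejected him. So in both cases the standing offer of `m` is the one
given by `ProposesTo`. -/

/-- In state `R`, the offer of `m` stands with `w`: `w` is his favourite woman among those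
who have not rejected him. -/
def ProposesTo {M W : Type*} (P : Profile M W) (R : Set (M × W)) (m : M) (w : W) : Prop :=
  (m, w) ∉ R ∧ ∀ w', (m, w') ∉ R → w' ≠ w → (P.man m).prefers w w'

/-- One round: every woman keeps her favourite among the offers standing with her and rejects the
rest. -/
def daRound {M W : Type*} (P : Profile M W) (R : Set (M × W)) : Set (M × W) :=
  R ∪ {p | P.ProposesTo R p.1 p.2 ∧
    ∃ m', P.ProposesTo R m' p.2 ∧ (P.woman p.2).prefers m' p.1}

/-- The rejections issued in the first `k` rounds. -/
def daRejections {M W : Type*} (P : Profile M W) : ℕ → Set (M × W)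
  | 0 => ∅
  | k + 1 => P.daRound (P.daRejections k)

theorem daRejections_terminates {M W : Type*} [Finite M] [Finite W] (P : Profile M W) :
    ∃ k, P.daRejections (k + 1) = P.daRejections k := by
  have hmono : Monotone P.daRejections :=
    monotone_nat_of_le_succ fun k => Set.subset_union_left
  obtain ⟨k, hk⟩ := WellFoundedGT.monotone_chain_condition
    (⟨P.daRejections, hmono⟩ : ℕ →o Set (M × W))
  exact ⟨k, (hk (k + 1) (Nat.le_succ k)).symm⟩

open Classical in
/-- The rejections when the algorithm stops, which is as soon as a round brings no new rejection
(so that nobody has a new proposal to make). -/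
noncomputable def daFinal {M W : Type*} [Finite M] [Finite W] (P : Profile M W) : Set (M × W) :=
  P.daRejections (Nat.find P.daRejections_terminates)

theorem daRound_daFinal {M W : Type*} [Finite M] [Finite W] (P : Profile M W) :
    P.daRound P.daFinal = P.daFinal := by
  classical
  exact Nat.find_spec P.daRejections_terminates

theorem ProposesTo.unique {M W : Type*} {P : Profile M W} {R : Set (M × W)} {m : M} {w w' : W}
    (h : P.ProposesTo R m w) (h' : P.ProposesTo R m w') : w = w' := by
  by_contra hne
  exact (P.man m).irrefl w
    ((P.man m).trans _ _ _ (h.2 w' h'.1 (Ne.symm hne)) (h'.2 w h.1 hne))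

/-- A woman who has rejected somebody has a standing offer. -/
theorem exists_proposesTo_of_mem {M W : Type*} [Finite M] (P : Profile M W) (k : ℕ) (m : M) (w : W)
    (h : (m, w) ∈ P.daRejections k) : ∃ m', P.ProposesTo (P.daRejections k) m' w := by
  induction k generalizing m with
  | zero => exact absurd h (Set.notMem_empty _)
  | succ k ih =>
    have hne : {m' | P.ProposesTo (P.daRejections k) m' w}.Nonempty := by
      rcases h with h | h
      · exact ih m h
      · exact ⟨m, h.1⟩
    obtain ⟨b, hb, hbest⟩ := (P.woman w).exists_favourite hne
    refine ⟨b, ?_, fun w' hw' hne' => hb.2 w' (fun hmem => hw' (Or.inl hmem)) hne'⟩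
    rintro (hmem | ⟨-, m', hm', hpref⟩)
    · exact hb.1 hmem
    · have hne' : m' ≠ b := by
        rintro rfl
        exact (P.woman w).irrefl _ hpref
      exact (P.woman w).irrefl _ ((P.woman w).trans _ _ _ hpref (hbest m' hm' hne'))

theorem daFinal_proposer_unique {M W : Type*} [Finite M] [Finite W] (P : Profile M W)
    {m m' : M} {w : W} (h : P.ProposesTo P.daFinal m w) (h' : P.ProposesTo P.daFinal m' w) :
    m = m' := by
  have key : ∀ {a b : M}, P.ProposesTo P.daFinal a w → P.ProposesTo P.daFinal b w →
      ¬ (P.woman w).prefers b a := by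
    intro a b ha hb hpref
    refine ha.1 ?_
    rw [← P.daRound_daFinal]
    exact Or.inr ⟨ha, b, hb, hpref⟩
  by_contra hne
  rcases (P.woman w).total m m' hne with hp | hp
  · exact key h' h hp
  · exact key h h' hp

/-- When the algorithm stops, every man has a standing offer. -/
theorem daFinal_exists_proposesTo {M W : Type*} [Finite M] [Finite W] (P : Profile M W) (m : M) :
    ∃ w, P.ProposesTo P.daFinal m w := by
  by_cases hall : ∀ w, (m, w) ∈ P.daFinal
  · have hex : ∀ w, ∃ m', P.ProposesTo P.daFinal m' w := fun w =>
      P.exists_proposesTo_of_mem _ m w (hall w)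
    choose f hf using hex
    have hinj : Function.Injective f := by
      intro w w' hww
      have h' := hf w'
      rw [← hww] at h'
      exact (hf w).unique h'
    have hbij := (Nat.bijective_iff_injective_and_card f).2 ⟨hinj, P.card_eq.symm⟩
    obtain ⟨w, rfl⟩ := hbij.2 m
    exact ⟨w, hf w⟩
  · obtain ⟨w₀, hw₀⟩ := not_forall.1 hall
    obtain ⟨w, hw, hbest⟩ := (P.man m).exists_favourite (S := {w | (m, w) ∉ P.daFinal}) ⟨w₀, hw₀⟩
    exact ⟨w, hw, hbest⟩

/-- The matching computed by the deferred acceptance algorithm: every man is matched with the woman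
who holds his offer when the algorithm stops. A matching is a bijection `μ : M ≃ W`; the partner of
a woman `w` is `μ.symm w`. -/
noncomputable def DA {M W : Type*} [Finite M] [Finite W] (P : Profile M W) : M ≃ W :=
  Equiv.ofBijective (fun m => (P.daFinal_exists_proposesTo m).choose) (by
    refine (Nat.bijective_iff_injective_and_card _).2 ⟨?_, P.card_eq⟩
    intro m m' hmm
    have h := (P.daFinal_exists_proposesTo m).choose_spec
    have h' := (P.daFinal_exists_proposesTo m').choose_spec
    dsimp only at hmm
    rw [← hmm] at h'
    exact P.daFinal_proposer_unique h h')

/-! ### Accomplice manipulation for the benefit of all women -/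

open Classical in
/-- The profile in which the man `m` reports the list `L` and everybody else is truthful. -/
noncomputable def report {M W : Type*} (P : Profile M W) (m : M) (L : PrefList W) :
    Profile M W where
  man := Function.update P.man m L
  woman := P.woman
  card_eq := P.card_eq

/-- Every woman weakly prefers `μ` to `ν`. -/
def WomenWeaklyPrefer {M W : Type*} (P : Profile M W) (μ ν : M ≃ W) : Prop :=
  ∀ w, (P.woman w).weaklyPrefers (μ.symm w) (ν.symm w)

/-- The accomplice `m` incurs no regret by reporting `L`: by his true list, his match does not
worsen. -/
def NoRegret {M W : Type*} [Finite M] [Finite W] (P : Profile M W) (m : M) (L : PrefList W) :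
    Prop :=
  (P.man m).weaklyPrefers ((P.report m L).DA m) (P.DA m)

/-- The list `L` is an optimal one-for-all strategy of the accomplice `m`: it is without regret,
all women weakly prefer its outcome to the truthful outcome, and all women weakly prefer its outcome
to that of any other no-regret strategy. -/
def IsOptimalStrategy {M W : Type*} [Finite M] [Finite W] (P : Profile M W) (m : M)
    (L : PrefList W) : Prop :=
  P.NoRegret m L ∧
  P.WomenWeaklyPrefer (P.report m L).DA P.DA ∧
  ∀ L' : PrefList W, P.NoRegret m L' → P.WomenWeaklyPrefer (P.report m L).DA (P.report m L').DA

/-- The set of women whose individual push-up above his partner `P.DA m` causes no regret to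
`m`. -/
def noRegretSet {M W : Type*} [Finite M] [Finite W] (P : Profile M W) (m : M) : Set W :=
  {w | P.NoRegret m ((P.man m).pushUp (P.DA m) {w})}

end Profile

/-!
Write `a` for the truthful partner of the accomplice `m`, and call the set of women whom a list
ranks above `a` its upper set.

By strategy-proofness of deferred acceptance, the outcome of a no-regret strategy matches `m` with
`a` (`noRegret_iff`). A matching that gives `a` to `m` is stable for the reported profile exactly
when no pair without `m` blocks it and no woman in the upper set prefers `m` to her partner. So a
larger upper set leaves fewer such matchings. As deferred acceptance yields the worst stable
matching for the women, a no-regret strategy with a larger upper set is better for all of them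
(`womenWeaklyPrefer_of_upper_subset`).

It remains to see that the truthful upper set enlarged by the no-regret set is the largest upper
set of a no-regret strategy. Both halves come from strategy-proofness at manipulated profiles. If
a no-regret strategy has `w` in its upper set and pushing up `w` alone led to regret, then pushing
up `w` would bring `w` to `m`, and this would be a profitable deviation from that strategy
(`mem_upperPart_of_noRegret`). If pushing up the whole no-regret set led to regret, it would bring
some `w` of that set to `m`, and this would be a profitable deviation from pushing up `w` alone
(`noRegret_of_isPushUp`).

Strategy-proofness and optimality for the men both follow from the blocking lemma
(`exists_blocks_of_prefers`): if some men strictly prefer a matching `ν` to the outcome of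
deferred acceptance, then `ν` is blocked by a pair whose man is not one of them.
-/

namespace PrefList

theorem asymm {α : Type*} (L : PrefList α) {x y : α} (h : L.prefers x y) : ¬ L.prefers y x :=
  fun h' => L.irrefl x (L.trans _ _ _ h h')

theorem isPushUp_pushUp {α : Type*} (L : PrefList α) (a : α) (X : Set α) :
    L.IsPushUp a X (L.pushUp a X) := by
  intro x
  have ha : a ∉ L.upperPart a X := fun h => h.elim (L.irrefl a) fun h => h.2 rfl
  constructor
  · rintro (h | ⟨-, h⟩)
    · exact h.1
    · exact Or.inl h
  · exact fun h => Or.inl ⟨h, ha⟩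

end PrefList

namespace Profile

variable {M W : Type*}

/-! ### Stable matchings -/

/-- The pair `(x, w)` blocks the matching `ν`: both strictly prefer each other to their partners. -/
def Blocks (P : Profile M W) (ν : M ≃ W) (x : M) (w : W) : Prop :=
  (P.man x).prefers w (ν x) ∧ (P.woman w).prefers x (ν.symm w)

/-- A matching is stable if no pair blocks it. -/
def IsStable (P : Profile M W) (ν : M ≃ W) : Prop :=
  ∀ x w, ¬ P.Blocks ν x w

/-! ### Reports of the accomplice -/

theorem report_man_self (P : Profile M W) (m : M) (L : PrefList W) :
    (P.report m L).man m = L := by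
  simp [report]

theorem report_man_of_ne (P : Profile M W) {m x : M} (L : PrefList W) (h : x ≠ m) :
    (P.report m L).man x = P.man x := by
  simp [report, h]

theorem report_truth (P : Profile M W) (m : M) : P.report m (P.man m) = P := by
  cases P
  simp [report]

/-! ### Rejections in the deferred acceptance algorithm -/

theorem daRejections_mono (P : Profile M W) : Monotone P.daRejections :=
  monotone_nat_of_le_succ fun _ => Set.subset_union_left

/-- An offer that has not been rejected stays in place while the rejections grow. -/
theorem ProposesTo.mono {P : Profile M W} {R S : Set (M × W)} (hRS : R ⊆ S) {x : M} {w : W}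
    (h : P.ProposesTo R x w) (hS : (x, w) ∉ S) : P.ProposesTo S x w :=
  ⟨hS, fun w' hw' hne => h.2 w' (fun hR => hw' (hRS hR)) hne⟩

/-- The best offer that a woman holds during a round survives this round. -/
theorem ProposesTo.exists_held [Finite M] {P : Profile M W} {k : ℕ} {x z : M} {w : W}
    (hz : P.ProposesTo (P.daRejections k) z w) (hzx : (P.woman w).prefers z x) :
    ∃ b, P.ProposesTo (P.daRejections k) b w ∧ P.ProposesTo (P.daRejections (k + 1)) b w ∧
      (P.woman w).prefers b x := by
  obtain ⟨b, hb, hbest⟩ := (P.woman w).exists_favourite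
    (S := {y | P.ProposesTo (P.daRejections k) y w}) ⟨z, hz⟩
  have hbx : (P.woman w).prefers b x := by
    by_cases hzb : z = b
    · exact hzb ▸ hzx
    · exact (P.woman w).trans _ _ _ (hbest z hz hzb) hzx
  refine ⟨b, hb, hb.mono Set.subset_union_left ?_, hbx⟩
  rintro (hmem | ⟨-, y, hy, hpref⟩)
  · exact hb.1 hmem
  · have hyb : y ≠ b := by
      rintro rfl
      exact (P.woman w).irrefl _ hpref
    exact (P.woman w).asymm hpref (hbest y hy hyb)

/-- A woman who has rejected `x` by the end of a round already held an offer better than `x` during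
that round and still holds it afterwards. -/
theorem exists_held_of_mem_succ [Finite M] (P : Profile M W) (k : ℕ) {x : M} {w : W}
    (h : (x, w) ∈ P.daRejections (k + 1)) :
    ∃ b, P.ProposesTo (P.daRejections k) b w ∧ P.ProposesTo (P.daRejections (k + 1)) b w ∧
      (P.woman w).prefers b x := by
  induction k with
  | zero =>
    rcases h with h | ⟨-, z, hz, hzx⟩
    · exact absurd h (Set.notMem_empty _)
    · exact hz.exists_held hzx
  | succ k ih =>
    rcases h with h | ⟨-, z, hz, hzx⟩
    · obtain ⟨z, -, hz, hzx⟩ := ih h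
      exact hz.exists_held hzx
    · exact hz.exists_held hzx

section Finite

variable [Finite M] [Finite W]

theorem proposesTo_DA (P : Profile M W) (x : M) : P.ProposesTo P.daFinal x (P.DA x) :=
  (P.daFinal_exists_proposesTo x).choose_spec

theorem mem_daFinal_of_prefers (P : Profile M W) {x : M} {w : W}
    (h : (P.man x).prefers w (P.DA x)) : (x, w) ∈ P.daFinal := by
  by_contra hn
  have hne : w ≠ P.DA x := by
    rintro rfl
    exact (P.man x).irrefl _ h
  exact (P.man x).asymm h ((P.proposesTo_DA x).2 w hn hne)

theorem isStable_DA (P : Profile M W) : P.IsStable P.DA := by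
  rintro x w ⟨hx, hw⟩
  have hmem := P.mem_daFinal_of_prefers hx
  rw [← P.daRound_daFinal] at hmem
  obtain ⟨y, -, hy, hyx⟩ := P.exists_held_of_mem_succ _ hmem
  change P.ProposesTo (P.daRound P.daFinal) y w at hy
  rw [P.daRound_daFinal] at hy
  obtain rfl := (P.proposesTo_DA y).unique hy
  rw [Equiv.symm_apply_apply] at hw
  exact (P.woman _).asymm hw hyx

/-! ### The blocking lemma and its consequences -/

/-- The blocking lemma when the men who strictly prefer `ν` have the same set of partners in both
matchings. The blocking man is found at the round in which one of these men is rejected for the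
last time. -/
theorem exists_blocks_of_image_eq (P : Profile M W) (ν : M ≃ W) {A : Set M}
    (hA : A = {x | (P.man x).prefers (ν x) (P.DA x)}) (hne : A.Nonempty)
    (himg : P.DA '' A ⊆ ν '' A) :
    ∃ x w, ¬ (P.man x).prefers (ν x) (P.DA x) ∧ P.Blocks ν x w := by
  classical
  have hex : ∃ j, ∀ x ∈ A, ∀ y, (x, y) ∈ P.daFinal → (x, y) ∈ P.daRejections j :=
    ⟨Nat.find P.daRejections_terminates, fun _ _ _ h => h⟩
  have hspec := Nat.find_spec hex
  have hmin := fun i => Nat.find_min hex (m := i)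
  have hle : P.daRejections (Nat.find hex) ⊆ P.daFinal :=
    P.daRejections_mono (Nat.find_min' hex fun _ _ _ h => h)
  generalize Nat.find hex = j at hspec hmin hle
  rcases j with _ | k
  · obtain ⟨x, hx⟩ := hne
    have hx' := hx
    rw [hA] at hx'
    exact absurd (hspec x hx _ (P.mem_daFinal_of_prefers hx')) (Set.notMem_empty _)
  have hk := hmin k (Nat.lt_succ_self k)
  push Not at hk
  obtain ⟨x, hxA, y, hy, hyk⟩ := hk
  have hxy : P.ProposesTo (P.daRejections k) x y := by
    rcases hspec x hxA y hy with h | h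
    · exact absurd h hyk
    · exact h.1
  -- In `ν`, the final partner of `x` has a man of `A`, and she has rejected him.
  obtain ⟨z, hzA, hz⟩ := himg ⟨x, hxA, rfl⟩
  have hz' := hzA
  rw [hA] at hz'
  have hzrej := hspec z hzA _ (P.mem_daFinal_of_prefers hz')
  rw [hz] at hzrej
  obtain ⟨b, hb, hb', hbz⟩ := P.exists_held_of_mem_succ k hzrej
  have hbx : b ≠ x := by
    rintro rfl
    have hyw := hxy.unique hb
    rw [hyw] at hy
    exact (P.proposesTo_DA b).1 hy
  have hbrej : (b, P.DA x) ∈ P.daFinal := by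
    by_contra hn
    exact hbx (P.DA.injective ((P.proposesTo_DA b).unique (hb'.mono hle hn)))
  -- No man of `A` is rejected after round `k + 1`, whereas `b` is.
  have hbA : b ∉ A := fun h => hb'.1 (hspec b h _ hbrej)
  have hbpref : (P.man b).prefers (P.DA x) (P.DA b) :=
    hb'.2 _ (fun h => (P.proposesTo_DA b).1 (hle h)) fun h => hbx (P.DA.injective h)
  rw [hA] at hbA
  refine ⟨b, P.DA x, hbA, ?_, ?_⟩
  · by_cases hbν : P.DA b = ν b
    · exact hbν ▸ hbpref
    · exact (P.man b).trans _ _ _ hbpref (((P.man b).total _ _ hbν).resolve_right hbA)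
  · rwa [← hz, Equiv.symm_apply_apply, hz]

/-- The blocking lemma: if some man strictly prefers `ν` to the outcome of deferred acceptance, then
`ν` is blocked by a pair whose man does not. -/
theorem exists_blocks_of_prefers (P : Profile M W) (ν : M ≃ W) {x₀ : M}
    (h₀ : (P.man x₀).prefers (ν x₀) (P.DA x₀)) :
    ∃ x w, ¬ (P.man x).prefers (ν x) (P.DA x) ∧ P.Blocks ν x w := by
  by_cases hsub : ν '' {x | (P.man x).prefers (ν x) (P.DA x)} ⊆
      P.DA '' {x | (P.man x).prefers (ν x) (P.DA x)}
  · refine P.exists_blocks_of_image_eq ν rfl ⟨x₀, h₀⟩ (Eq.subset ?_)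
    refine (Set.eq_of_subset_of_ncard_le hsub ?_ (Set.toFinite _)).symm
    rw [Set.ncard_image_of_injective _ P.DA.injective, Set.ncard_image_of_injective _ ν.injective]
  · obtain ⟨w, ⟨z, hz, rfl⟩, hw⟩ := Set.not_subset.1 hsub
    -- The blocking man is the partner of `ν z` in the outcome of deferred acceptance.
    obtain ⟨b, hb⟩ := P.DA.surjective (ν z)
    have hbA : ¬ (P.man b).prefers (ν b) (P.DA b) := fun h => hw ⟨b, h, hb⟩
    have hbz : b ≠ z := by
      rintro rfl
      exact hbA hz
    refine ⟨b, ν z, hbA, ?_, ?_⟩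
    · rw [← hb]
      refine ((P.man b).total _ _ fun h => hbz (ν.injective ?_)).resolve_right hbA
      rw [← h, hb]
    · rw [Equiv.symm_apply_apply]
      refine ((P.woman _).total b z hbz).resolve_right fun h => P.isStable_DA z (ν z) ⟨hz, ?_⟩
      rwa [← hb, Equiv.symm_apply_apply, hb]

theorem IsStable.not_prefers_DA {P : Profile M W} {ν : M ≃ W} (hν : P.IsStable ν) (x : M) :
    ¬ (P.man x).prefers (ν x) (P.DA x) := fun h => by
  obtain ⟨y, w, -, hb⟩ := P.exists_blocks_of_prefers ν h
  exact hν y w hb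

/-- Deferred acceptance yields the worst stable matching for the women. -/
theorem IsStable.womenWeaklyPrefer_DA {P : Profile M W} {ν : M ≃ W} (hν : P.IsStable ν) :
    P.WomenWeaklyPrefer ν P.DA := by
  intro w
  obtain ⟨x, rfl⟩ := P.DA.surjective w
  rw [Equiv.symm_apply_apply]
  by_cases heq : ν.symm (P.DA x) = x
  · exact Or.inr heq
  · refine Or.inl (((P.woman _).total _ _ heq).resolve_right fun h => hν x (P.DA x) ⟨?_, h⟩)
    refine ((P.man x).total _ _ fun h' => heq ?_).resolve_right (hν.not_prefers_DA x)
    rw [h', Equiv.symm_apply_apply]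

/-- Strategy-proofness: if `Q` differs from `P` only in the list of `m`, then `m` is not
better off in `Q` by his list in `P`. Otherwise the blocking lemma for `P` would provide a pair that
does not contain `m`, and this pair would block the outcome in `Q` as well. -/
theorem not_prefers_DA_of_eq_off (P Q : Profile M W) {m : M} (hw : Q.woman = P.woman)
    (hm : ∀ x, x ≠ m → Q.man x = P.man x) : ¬ (P.man m).prefers (Q.DA m) (P.DA m) := by
  intro h
  obtain ⟨x, w, hx, hb⟩ := P.exists_blocks_of_prefers Q.DA h
  have hxm : x ≠ m := by
    rintro rfl
    exact hx h
  refine Q.isStable_DA x w ⟨?_, ?_⟩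
  · rw [hm x hxm]
    exact hb.1
  · rw [hw]
    exact hb.2

/-! ### Manipulation by the accomplice -/

/-- By the list `L`, reporting `L` is at least as good for `m` as reporting any other list `L'`. -/
theorem not_prefers_DA_report (P : Profile M W) (m : M) (L L' : PrefList W) :
    ¬ L.prefers ((P.report m L').DA m) ((P.report m L).DA m) := by
  have h := (P.report m L).not_prefers_DA_of_eq_off (P.report m L') (m := m) rfl fun x hx => by
    rw [report_man_of_ne _ _ hx, report_man_of_ne _ _ hx]
  rwa [report_man_self] at h

theorem noRegret_iff (P : Profile M W) (m : M) (L : PrefList W) :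
    P.NoRegret m L ↔ (P.report m L).DA m = P.DA m := by
  have h := P.not_prefers_DA_report m (P.man m) L
  rw [report_truth] at h
  exact ⟨fun h' => h'.resolve_left h, Or.inr⟩

theorem noRegret_truth (P : Profile M W) (m : M) : P.NoRegret m (P.man m) := by
  rw [noRegret_iff, report_truth]

/-- A no-regret strategy with a larger upper set is better for all women: its outcome stays
stable when the upper set shrinks. -/
theorem womenWeaklyPrefer_of_upper_subset (P : Profile M W) (m : M) {L L' : PrefList W}
    (hL : P.NoRegret m L) (hsub : ∀ w, L'.prefers w (P.DA m) → L.prefers w (P.DA m)) :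
    P.WomenWeaklyPrefer (P.report m L).DA (P.report m L').DA := by
  have hst : (P.report m L').IsStable (P.report m L).DA := by
    rintro x w ⟨hx, hw⟩
    refine (P.report m L).isStable_DA x w ⟨?_, hw⟩
    by_cases hxm : x = m
    · subst hxm
      rw [report_man_self, (P.noRegret_iff x L).1 hL] at hx ⊢
      exact hsub w hx
    · rw [report_man_of_ne _ _ hxm] at hx ⊢
      exact hx
  exact hst.womenWeaklyPrefer_DA

/-- If pushing up `X` changes the partner of `m`, his new partner belongs to `X`. -/
theorem mem_of_isPushUp_of_ne (P : Profile M W) (m : M) {X : Set W} {L : PrefList W}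
    (hL : (P.man m).IsPushUp (P.DA m) X L) (hne : (P.report m L).DA m ≠ P.DA m) :
    (P.report m L).DA m ∈ X := by
  have htruth := P.not_prefers_DA_report m (P.man m) L
  -- By `L`, reporting `L` is at least as good for `m` as the truth, which would give him `P.DA m`.
  have hback := P.not_prefers_DA_report m L (P.man m)
  rw [report_truth] at htruth hback
  exact (((hL _).1 ((L.total _ _ hne).resolve_right hback)).resolve_left htruth).1

/-- The upper set of a no-regret strategy is contained in that of a push-up of the no-regret
set. -/
theorem mem_upperPart_of_noRegret (P : Profile M W) (m : M) {L : PrefList W}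
    (hL : P.NoRegret m L) {w : W} (hw : L.prefers w (P.DA m)) :
    w ∈ (P.man m).upperPart (P.DA m) (P.noRegretSet m) := by
  refine Or.inr ⟨?_, ?_⟩
  · refine (P.noRegret_iff m _).2 ?_
    by_contra hne
    have hmem := mem_of_isPushUp_of_ne P m (PrefList.isPushUp_pushUp _ _ _) hne
    have h := P.not_prefers_DA_report m L ((P.man m).pushUp (P.DA m) {w})
    rw [Set.mem_singleton_iff.1 hmem, (P.noRegret_iff m L).1 hL] at h
    exact h hw
  · rintro rfl
    exact L.irrefl _ hw

theorem noRegret_of_isPushUp (P : Profile M W) (m : M) {L : PrefList W}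
    (hL : (P.man m).IsPushUp (P.DA m) (P.noRegretSet m) L) : P.NoRegret m L := by
  rw [noRegret_iff]
  by_contra hne
  have hmem := mem_of_isPushUp_of_ne P m hL hne
  have hnr := (P.noRegret_iff m _).1 hmem
  have h := P.not_prefers_DA_report m
    ((P.man m).pushUp (P.DA m) {(P.report m L).DA m}) L
  rw [hnr] at h
  exact h ((PrefList.isPushUp_pushUp _ _ _ _).2 (Or.inr ⟨rfl, hne⟩))

theorem isOptimalStrategy_of_isPushUp (P : Profile M W) (m : M) {L : PrefList W}
    (hL : (P.man m).IsPushUp (P.DA m) (P.noRegretSet m) L) : P.IsOptimalStrategy m L := by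
  have hopt : ∀ L' : PrefList W, P.NoRegret m L' →
      P.WomenWeaklyPrefer (P.report m L).DA (P.report m L').DA := fun L' hL' =>
    P.womenWeaklyPrefer_of_upper_subset m (noRegret_of_isPushUp P m hL) fun w hw =>
      (hL w).2 (P.mem_upperPart_of_noRegret m hL' hw)
  have htruth := hopt _ (P.noRegret_truth m)
  rw [report_truth] at htruth
  exact ⟨noRegret_of_isPushUp P m hL, htruth, hopt⟩

end Finite

end Profile

theorem mainTheorem2 {M W : Type*} [Finite M] [Finite W] (P : Profile M W) (m : M) :
    (∃ L : PrefList W, P.IsOptimalStrategy m L) ∧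
    P.IsOptimalStrategy m ((P.man m).pushUp (P.DA m) (P.noRegretSet m)) ∧
    ∀ L : PrefList W, (P.man m).IsPushUp (P.DA m) (P.noRegretSet m) L →
      P.IsOptimalStrategy m L := by
  have h := Profile.isOptimalStrategy_of_isPushUp P m
    ((P.man m).isPushUp_pushUp (P.DA m) (P.noRegretSet m))
  exact ⟨⟨_, h⟩, h, fun L hL => Profile.isOptimalStrategy_of_isPushUp P m hL⟩
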